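/- All graphs are finite and simple. The spectral radius $\rho(G)$ of a graph $G$ is the largest eigenvalue of its adjacency matrix. A graph is $t$-connected if it has more than $t$ vertices and remains connected after the deletion of any set of fewer than $t$ vertices. For a positive integer $k$, a perfect $k$-matching of $G$ is a function $f:E(G)\to\{0,1,\dots,k\}$ such that $\sum_{e\ni v}f(e)=k$ for every vertex $v$ of $G$. As usual, $\cup$ denotes disjoint union, $mK_1$ is the graph with $m$ vertices and no edges, and the join $G_1\vee G_2$ is obtained from $G_1\cup G_2$ by joining every vertex of $G_1$ to every vertex of $G_2$. **Theorem 1.2.** Let $t$ and $k$ be positive integers with $k$ odd, and let $G$ be a $t$-connected graph of even order $n\ge 5t+3$. If $$\rho(G)\ge\rho\bigl(K_t\vee(K_{n-2t-1}\cup(t+1)K_1)\bigr),$$ then $G$ has a perfect $k$-matching, unless $G$ is isomorphic to $K_t\vee(K_{n-2t-1}\cup(t+1)K_1)$, in which case $G$ has no perfect $k$-matching. -/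

import Mathlib

namespace SimpleGraph

/-- The join `G ∨ H`: the disjoint union of `G` and `H` together with all edges joining a vertex of
`G` to a vertex of `H`. -/
def graphJoin {V W : Type*} (G : SimpleGraph V) (H : SimpleGraph W) : SimpleGraph (V ⊕ W) :=
  (G ⊕g H) ⊔ completeBipartiteGraph V W

/-- The graph `K_t ∨ (K_{n-2t-1} ∪ (t+1) K_1)`. It is used for `n ≥ 2t + 1`, where it has order
`n`. -/
def extremalGraph (n t : ℕ) :
    SimpleGraph (Fin t ⊕ (Fin (n - 2 * t - 1) ⊕ Fin (t + 1))) :=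
  graphJoin (completeGraph (Fin t)) (completeGraph (Fin (n - 2 * t - 1)) ⊕g emptyGraph (Fin (t + 1)))

/-- `G` is `t`-connected: it has more than `t` vertices, and `G - S` is connected for every set `S`
of fewer than `t` vertices. -/
def IsVertexConnected {V : Type*} [Fintype V] (G : SimpleGraph V) (t : ℕ) : Prop :=
  t < Fintype.card V ∧ ∀ S : Finset V, S.card < t → (G.induce {v | v ∉ S}).Connected

open Classical in
/-- The adjacency spectral radius `ρ(G)`: the largest eigenvalue of the adjacency matrix. -/
noncomputable def adjSpectralRadius {V : Type*} [Fintype V] (G : SimpleGraph V) : ℝ :=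
  sSup {μ : ℝ | Module.End.HasEigenvalue (Matrix.toLin' (G.adjMatrix ℝ)) μ}

open Classical in
/-- For a nonempty graph the supremum defining `ρ(G)` is attained: `ρ(G)` is the largest
eigenvalue. -/
theorem isGreatest_adjSpectralRadius {V : Type*} [Fintype V] [Nonempty V] (G : SimpleGraph V) :
    IsGreatest {μ : ℝ | Module.End.HasEigenvalue (Matrix.toLin' (G.adjMatrix ℝ)) μ}
      G.adjSpectralRadius := by
  have hA : (G.adjMatrix ℝ).IsHermitian := by
    ext i j
    simp [adjMatrix_apply, adj_comm]
  have hs : {μ : ℝ | Module.End.HasEigenvalue (Matrix.toLin' (G.adjMatrix ℝ)) μ} =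
      Set.range hA.eigenvalues := by
    rw [← hA.spectrum_real_eq_range_eigenvalues, ← Matrix.spectrum_toLin']
    ext μ
    exact Module.End.hasEigenvalue_iff_mem_spectrum
  have hfin : (Set.range hA.eigenvalues).Finite := Set.finite_range _
  have hne : (Set.range hA.eigenvalues).Nonempty := Set.range_nonempty _
  unfold adjSpectralRadius
  rw [hs]
  exact ⟨hne.csSup_mem hfin, fun x hx => le_csSup hfin.bddAbove hx⟩

open Classical in
/-- `f : E(G) → {0, 1, …, k}` is a `k`-matching of `G`: at every vertex the values of `f` on the
incident edges sum to at most `k`. -/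
def IsKMatching {V : Type*} [Fintype V] (G : SimpleGraph V) (k : ℕ) (f : G.edgeSet → ℕ) : Prop :=
  (∀ e, f e ≤ k) ∧
    ∀ v : V, ∑ e ∈ Finset.univ.filter (fun e : G.edgeSet => v ∈ (e : Sym2 V)), f e ≤ k

open Classical in
/-- A perfect `k`-matching of `G`: a `k`-matching for which the sum at every vertex equals `k`. -/
def IsPerfectKMatching {V : Type*} [Fintype V] (G : SimpleGraph V) (k : ℕ) (f : G.edgeSet → ℕ) :
    Prop :=
  G.IsKMatching k f ∧ ∀ v : V, ∑ e ∈ Finset.univ.filter (fun e : G.edgeSet => v ∈ (e : Sym2 V)), f e = k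

end SimpleGraph

/-!
For odd `k` a perfect matching `M` gives the perfect `k`-matching `k · 1_M`, so it suffices to find
a perfect matching when `G` is not the extremal graph. Otherwise Tutte's theorem and parity give a
set `S` of `s` vertices whose removal leaves at least `s + 2` components, and `s ≥ t` by
connectivity.

Let `x ≥ 0` be the absolute value of an eigenvector for `ρ(G)`. The graph `G` is compared with
`K_s ∨ (K_{n-2s-1} ∪ (s+1) K_1)` on the same vertex set, here `coreGraph S W`: keep one component
of maximal `x`-weight, isolate one vertex of each of `s + 1` other components, and merge everything
else into the kept component. This does not decrease the quadratic form at `x`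
(`exists_coreGraph_quadraticForm_le`).

Perron–Frobenius theory is replaced by explicit vectors. The function `coreCubic n t` has a zero
`l ≥ n - t - 2`, which is an eigenvalue of the extremal graph, so `l ≤ ρ(G)`. A positive test vector
`y`, constant on the three vertex classes, satisfies `A y ≤ l y` for the core graph because
`coreCubic n s l ≥ coreCubic n t l = 0`; this is where `n ≥ 5t + 3` enters
(`coreCubic_lt_coreCubic`). Hence all inequalities are equalities. By `eq_of_le_quadraticForm`, `x` is
a multiple of `y`, hence positive, so `s = t` and `G` is the core graph.

Conversely, in the extremal graph `t + 1` independent vertices have only `t` neighbours, which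
excludes a perfect `k`-matching by counting weights.
-/

namespace SimpleGraph

/-! ### Perfect `k`-matchings and Tutte's theorem -/

open Classical in
theorem exists_isPerfectKMatching_of_isPerfectMatching {V : Type*} [Fintype V] {G : SimpleGraph V}
    {M : G.Subgraph} (hM : M.IsPerfectMatching) (k : ℕ) :
    ∃ f : G.edgeSet → ℕ, G.IsPerfectKMatching k f := by
  have key : ∀ v : V, ∑ e ∈ Finset.univ.filter (fun e : G.edgeSet => v ∈ (e : Sym2 V)),
      (if (e : Sym2 V) ∈ M.edgeSet then k else 0) = k := by
    intro v
    obtain ⟨w, hw, huniq⟩ := hM.1 (hM.2 v)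
    have hG : s(v, w) ∈ G.edgeSet := M.adj_sub hw
    rw [Finset.sum_eq_single_of_mem ⟨s(v, w), hG⟩ (by simp)]
    · exact if_pos hw
    · rintro ⟨e, he⟩ hmem hne
      refine if_neg fun heM => hne ?_
      have hv : v ∈ e := by simpa using hmem
      obtain ⟨w', rfl⟩ := Sym2.mem_iff_exists.mp hv
      have := huniq w' heM
      subst this
      rfl
  refine ⟨fun e => if (e : Sym2 V) ∈ M.edgeSet then k else 0, ⟨fun e => ?_, fun v => (key v).le⟩, key⟩
  dsimp only
  split_ifs <;> simp

open Classical in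
/-- Every edge has at least as many endpoints in `S` as in `W`, so the total weight at the vertices
of `W` is at most the total weight at the vertices of `S`. -/
theorem not_isPerfectKMatching_of_card_lt {V : Type*} [Fintype V] {G : SimpleGraph V} {k : ℕ}
    (hk : 0 < k) {S W : Finset V} (hcard : S.card < W.card)
    (hadj : ∀ u v, G.Adj u v → u ∈ W → v ∈ S) (f : G.edgeSet → ℕ) :
    ¬ G.IsPerfectKMatching k f := by
  intro hf
  have total : ∀ T : Finset V, T.card * k =
      ∑ e : G.edgeSet, (T.filter (fun v => v ∈ (e : Sym2 V))).card * f e := by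
    intro T
    calc T.card * k = ∑ v ∈ T, ∑ e : G.edgeSet, if v ∈ (e : Sym2 V) then f e else 0 := by
          rw [← smul_eq_mul, ← Finset.sum_const]
          refine Finset.sum_congr rfl fun v _ => ?_
          rw [← Finset.sum_filter]
          exact (hf.2 v).symm
      _ = _ := by
          rw [Finset.sum_comm]
          refine Finset.sum_congr rfl fun e _ => ?_
          rw [← Finset.sum_filter, Finset.sum_const, smul_eq_mul]
  have hle : W.card * k ≤ S.card * k := by
    rw [total W, total S]
    refine Finset.sum_le_sum fun e _ => Nat.mul_le_mul_right _ ?_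
    obtain ⟨e, he⟩ := e
    induction e using Sym2.ind with
    | _ u v =>
      have huv : G.Adj u v := he
      -- Exchanging the endpoints of the edge maps its endpoints in `W` into `S`.
      refine Finset.card_le_card_of_injOn (Equiv.swap u v) ?_ (Equiv.injective _).injOn
      intro w hw
      obtain ⟨hwW, hw⟩ : w ∈ W ∧ w ∈ s(u, v) := by simpa using hw
      rcases Sym2.mem_iff.mp hw with rfl | rfl
      · simpa using hadj _ _ huv hwW
      · simpa using hadj _ _ huv.symm hwW
  exact absurd (Nat.le_of_mul_le_mul_right hle hk) (by omega)

open Classical in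
/-- Tutte's theorem in terms of a labelling `κ`: the vertices labelled `none` form the violating set
and the others are labelled by their component after its removal. The number of odd components
exceeds the size of the set, and has the same parity. -/
theorem exists_component_labelling.{u} {V : Type u} [Fintype V] {G : SimpleGraph V}
    (heven : Even (Fintype.card V)) (hG : ¬ ∃ M : G.Subgraph, M.IsPerfectMatching) :
    ∃ (S : Finset V) (α : Type u) (_ : Fintype α) (κ : V → Option α),
      (∀ v, κ v = none ↔ v ∈ S) ∧ (∀ i, ∃ v, κ v = some i) ∧
      (∀ u v, G.Adj u v → u ∉ S → v ∉ S → κ u = κ v) ∧ S.card + 2 ≤ Fintype.card α := by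
  rw [tutte] at hG
  push Not at hG
  obtain ⟨U, hU⟩ := hG
  rw [IsTutteViolator] at hU
  set H := ((⊤ : G.Subgraph).deleteVerts U).coe with hH
  have hmem : ∀ v, v ∈ ((⊤ : G.Subgraph).deleteVerts U).verts ↔ v ∉ U := by simp
  have hUS : U.ncard = U.toFinset.card := Set.ncard_eq_toFinset_card' U
  have hpar := H.odd_ncard_oddComponents
  have hcardH : Nat.card ((⊤ : G.Subgraph).deleteVerts U).verts + U.ncard = Fintype.card V := by
    have : ((⊤ : G.Subgraph).deleteVerts U).verts = Uᶜ := by ext v; simp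
    rw [this, Nat.card_coe_set_eq, ← Nat.card_eq_fintype_card, add_comm]
    exact Set.ncard_add_ncard_compl U
  have hle : H.oddComponents.ncard ≤ Fintype.card H.ConnectedComponent := by
    rw [← Nat.card_eq_fintype_card, ← Set.ncard_univ]
    exact Set.ncard_le_ncard (Set.subset_univ _)
  refine ⟨U.toFinset, H.ConnectedComponent, inferInstance,
    fun v => if h : v ∈ U then none else some (H.connectedComponentMk ⟨v, (hmem v).2 h⟩),
    ?_, ?_, ?_, ?_⟩
  · intro v
    by_cases h : v ∈ U <;> simp [h]
  · intro i
    induction i using ConnectedComponent.ind with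
    | _ v =>
      refine ⟨v, ?_⟩
      have : (v : V) ∉ U := (hmem v).1 v.2
      simp [this]
  · intro u v huv hu hv
    have hu : u ∉ U := by simpa using hu
    have hv : v ∉ U := by simpa using hv
    simp only [hu, hv, dite_false]
    refine congrArg some (ConnectedComponent.sound (Adj.reachable ?_))
    simp [hH, hu, hv, huv]
  · rw [Nat.even_iff] at heven
    rw [Nat.odd_iff, Nat.odd_iff] at hpar
    omega

/-- Deleting a set that leaves at least two components requires at least `t` vertices. -/
theorem IsVertexConnected.le_card_of_labelling {V α : Type*} [Fintype V] {G : SimpleGraph V} {t : ℕ}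
    (hG : G.IsVertexConnected t) {S : Finset V} {κ : V → Option α}
    (hadj : ∀ u v, G.Adj u v → u ∉ S → v ∉ S → κ u = κ v) {u v : V} (hu : u ∉ S) (hv : v ∉ S)
    (huv : κ u ≠ κ v) : t ≤ S.card := by
  by_contra! hlt
  refine huv ?_
  obtain ⟨p⟩ := (hG.2 S hlt).preconnected ⟨u, hu⟩ ⟨v, hv⟩
  have : ∀ {a b : {v | v ∉ S}} (p : (G.induce {v | v ∉ S}).Walk a b), κ a = κ b := by
    intro a b p
    induction p with
    | nil => rfl
    | @cons a b c h p ih => exact (hadj a b h a.2 b.2).trans ih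
  exact this p

/-! ### Quadratic forms and comparison with core graphs -/

/-- The equality case of the Collatz–Wielandt bound: a positive `y` with `A y ≤ l y` bounds the
quadratic form of a symmetric nonnegative `A` by `l ‖x‖²`. If `x` attains the bound, then `A y = l y`
on the support of `x`, and `x / y` is constant along the nonzero entries of `A`. -/
theorem eq_of_le_quadraticForm {V : Type*} [Fintype V] {A : V → V → ℝ}
    (hsymm : ∀ u v, A u v = A v u) (hA : ∀ u v, 0 ≤ A u v) {y : V → ℝ} (hy : ∀ v, 0 < y v) {l : ℝ}
    (hle : ∀ u, ∑ v, A u v * y v ≤ l * y u) {x : V → ℝ}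
    (hx : l * ∑ u, x u ^ 2 ≤ ∑ u, ∑ v, A u v * x u * x v) :
    (∀ u, x u ≠ 0 → ∑ v, A u v * y v = l * y u) ∧
      ∀ u v, A u v ≠ 0 → x u / y u = x v / y v := by
  obtain ⟨z, rfl⟩ : ∃ z : V → ℝ, x = fun v => z v * y v :=
    ⟨fun v => x v / y v, funext fun v => (div_mul_cancel₀ _ (hy v).ne').symm⟩
  have hterm₁ : ∀ u, 0 ≤ (l * y u - ∑ v, A u v * y v) * (y u * z u ^ 2) := fun u =>
    mul_nonneg (sub_nonneg.2 (hle u)) (mul_nonneg (hy u).le (sq_nonneg _))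
  have hterm₂ : ∀ u v, 0 ≤ A u v * y u * y v * (z u - z v) ^ 2 := fun u v =>
    mul_nonneg (mul_nonneg (mul_nonneg (hA u v) (hy u).le) (hy v).le) (sq_nonneg _)
  have hswap : ∑ u, ∑ v, A u v * y u * y v * z v ^ 2 = ∑ u, ∑ v, A u v * y u * y v * z u ^ 2 := by
    rw [Finset.sum_comm]
    refine Finset.sum_congr rfl fun u _ => Finset.sum_congr rfl fun v _ => ?_
    rw [hsymm v u]; ring
  have h₁ : ∑ u, (l * y u - ∑ v, A u v * y v) * (y u * z u ^ 2) =
      l * ∑ u, (z u * y u) ^ 2 - ∑ u, ∑ v, A u v * y u * y v * z u ^ 2 := by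
    rw [Finset.mul_sum, ← Finset.sum_sub_distrib]
    refine Finset.sum_congr rfl fun u _ => ?_
    rw [sub_mul, Finset.sum_mul]
    congr 1
    · ring
    · exact Finset.sum_congr rfl fun v _ => by ring
  have h₂ : ∑ u, ∑ v, A u v * y u * y v * (z u - z v) ^ 2 =
      ∑ u, ∑ v, A u v * y u * y v * z u ^ 2 + ∑ u, ∑ v, A u v * y u * y v * z v ^ 2
        - 2 * ∑ u, ∑ v, A u v * (z u * y u) * (z v * y v) := by
    simp only [Finset.mul_sum, ← Finset.sum_add_distrib, ← Finset.sum_sub_distrib]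
    exact Finset.sum_congr rfl fun u _ => Finset.sum_congr rfl fun v _ => by ring
  have hn₁ := Finset.sum_nonneg fun u (_ : u ∈ Finset.univ) => hterm₁ u
  have hn₂ := Finset.sum_nonneg fun u (_ : u ∈ Finset.univ) =>
    Finset.sum_nonneg fun v (_ : v ∈ Finset.univ) => hterm₂ u v
  have hz₁ : ∑ u, (l * y u - ∑ v, A u v * y v) * (y u * z u ^ 2) = 0 := by linarith
  have hz₂ : ∑ u, ∑ v, A u v * y u * y v * (z u - z v) ^ 2 = 0 := by linarith
  rw [Finset.sum_eq_zero_iff_of_nonneg fun u _ => hterm₁ u] at hz₁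
  rw [Finset.sum_eq_zero_iff_of_nonneg fun u _ => Finset.sum_nonneg fun v _ => hterm₂ u v] at hz₂
  refine ⟨fun u hu => ?_, fun u v huv => ?_⟩
  · have h := hz₁ u (Finset.mem_univ u)
    have hzu : z u ≠ 0 := left_ne_zero_of_mul hu
    rcases mul_eq_zero.1 h with h | h
    · linarith
    · exact absurd h (mul_ne_zero (hy u).ne' (pow_ne_zero _ hzu))
  · have h := hz₂ u (Finset.mem_univ u)
    rw [Finset.sum_eq_zero_iff_of_nonneg fun v _ => hterm₂ u v] at h
    have h := h v (Finset.mem_univ v)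
    have hzz : z u - z v = 0 := by
      by_contra hne
      exact mul_ne_zero (mul_ne_zero (mul_ne_zero huv (hy u).ne') (hy v).ne') (pow_ne_zero 2 hne) h
    rw [mul_div_cancel_right₀ _ (hy u).ne', mul_div_cancel_right₀ _ (hy v).ne']
    linarith

open Classical in
/-- The absolute value of an eigenvector for the largest eigenvalue is a nonnegative vector whose
Rayleigh quotient is at least `ρ(G)`. -/
theorem exists_nonneg_adjSpectralRadius_le {V : Type*} [Fintype V] [Nonempty V]
    (G : SimpleGraph V) : ∃ x : V → ℝ, (∀ v, 0 ≤ x v) ∧ (∃ v, x v ≠ 0) ∧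
      G.adjSpectralRadius * ∑ u, x u ^ 2 ≤ ∑ u, ∑ v, G.adjMatrix ℝ u v * x u * x v := by
  obtain ⟨z, hz⟩ := (isGreatest_adjSpectralRadius G).1.exists_hasEigenvector
  have heq := hz.apply_eq_smul
  refine ⟨fun v => |z v|, fun v => abs_nonneg _, ?_, ?_⟩
  · by_contra! h
    exact hz.2 (funext fun v => abs_eq_zero.1 (h v))
  · have h : ∀ u, ∑ v, G.adjMatrix ℝ u v * z v = G.adjSpectralRadius * z u := fun u => by
      simpa [Matrix.mulVec, dotProduct] using congrFun heq u
    calc G.adjSpectralRadius * ∑ u, |z u| ^ 2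
        = ∑ u, ∑ v, G.adjMatrix ℝ u v * z u * z v := by
          rw [Finset.mul_sum]
          refine Finset.sum_congr rfl fun u _ => ?_
          rw [sq_abs, sq, ← mul_assoc, ← h u, Finset.sum_mul]
          exact Finset.sum_congr rfl fun v _ => by ring
      _ ≤ _ := by
          refine Finset.sum_le_sum fun u _ => Finset.sum_le_sum fun v _ => ?_
          rw [mul_assoc, mul_assoc, ← abs_mul]
          refine mul_le_mul_of_nonneg_left (le_abs_self _) ?_
          rw [adjMatrix_apply]
          split_ifs <;> norm_num

/-- The graph on `V` in which distinct vertices are adjacent unless one of them lies in `W` and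
neither lies in `S`. For disjoint `S` and `W` this is
`K_{|S|} ∨ (K_{|V| - |S| - |W|} ∪ |W| K_1)`. -/
def coreGraph {V : Type*} (S W : Finset V) : SimpleGraph V where
  Adj u v := u ≠ v ∧ (u ∈ S ∨ v ∈ S ∨ (u ∉ W ∧ v ∉ W))
  symm := ⟨fun u v h => ⟨h.1.symm, by tauto⟩⟩
  loopless := ⟨fun u h => h.1 rfl⟩

open Classical in
/-- Replacing `G` by a core graph does not decrease its quadratic form at `x ≥ 0`, and for
positive `x` it increases it unless nothing changes.
The components of `G - S` are the fibres of `κ`. Let `C` be one of maximal `x`-weight, and let `W`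
consist of one vertex from each of `|S| + 1` other components. Isolating `w ∈ W` from the rest `D_w`
of its component loses at most `x(w) x(D_w)`, and joining `D_w` to `C` gains `x(D_w) x(C)`, where
`x(C) ≥ x(w) + x(D_w)`. -/
theorem exists_coreGraph_quadraticForm_le {V α : Type*} [Fintype V] [Fintype α] {G : SimpleGraph V}
    {S : Finset V} {κ : V → Option α} (hS : ∀ v, κ v = none ↔ v ∈ S)
    (hsurj : ∀ i, ∃ v, κ v = some i) (hadj : ∀ u v, G.Adj u v → u ∉ S → v ∉ S → κ u = κ v)
    (hcard : S.card + 2 ≤ Fintype.card α) {x : V → ℝ} (hx : ∀ v, 0 ≤ x v) :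
    ∃ W : Finset V, Disjoint S W ∧ W.card = S.card + 1 ∧
      ∑ u, ∑ v, G.adjMatrix ℝ u v * x u * x v ≤
        ∑ u, ∑ v, (coreGraph S W).adjMatrix ℝ u v * x u * x v ∧
      ((∀ v, 0 < x v) → ∑ u, ∑ v, (coreGraph S W).adjMatrix ℝ u v * x u * x v ≤
        ∑ u, ∑ v, G.adjMatrix ℝ u v * x u * x v → G = coreGraph S W) := by
  choose w hw using hsurj
  have hw_inj : Function.Injective w := fun i j h => by
    have := hw i; rw [h, hw j] at this; exact (Option.some_injective _ this).symm
  let wt : α → ℝ := fun i => ∑ v ∈ Finset.univ.filter (fun v => κ v = some i), x v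
  have hα : (Finset.univ : Finset α).Nonempty := by
    rw [← Finset.card_pos, Finset.card_univ]; omega
  obtain ⟨m, -, hm⟩ := Finset.exists_max_image Finset.univ wt hα
  obtain ⟨T, hTm, hT⟩ : ∃ T ⊆ Finset.univ.erase m, T.card = S.card + 1 := by
    refine Finset.exists_subset_card_eq ?_
    rw [Finset.card_erase_of_mem (Finset.mem_univ _), Finset.card_univ]; omega
  have hmT : m ∉ T := fun h => by simpa using hTm h
  let W := T.image w
  have hW : ∀ v, v ∈ W ↔ ∃ i ∈ T, w i = v := fun v => by simp [W]
  -- `D v i` says that `v` lies in the component `i ∈ T` without being its chosen vertex `w i`.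
  let D : V → α → Prop := fun v i => i ∈ T ∧ κ v = some i ∧ v ≠ w i
  let L : V → V → ℝ := fun u v => if ∃ i, D v i ∧ u = w i then 1 else 0
  let K : V → V → ℝ := fun u v => if κ u = some m ∧ ∃ i, D v i then 1 else 0
  have hpt : ∀ u v, G.adjMatrix ℝ u v ≤
      (coreGraph S W).adjMatrix ℝ u v + (L u v + L v u) - (K u v + K v u) := by
    have hK : ∀ u v, (κ u = some m ∧ ∃ i, D v i) →
        ¬ (κ v = some m ∧ ∃ i, D u i) ∧ ¬ G.Adj u v ∧ (coreGraph S W).Adj u v := by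
      rintro u v ⟨hu, i, hi, hv, hvw⟩
      have him : i ≠ m := fun h => hmT (h ▸ hi)
      have huS : u ∉ S := fun h => by simp [(hS u).2 h] at hu
      have hvS : v ∉ S := fun h => by simp [(hS v).2 h] at hv
      have huv : κ u ≠ κ v := by rw [hu, hv]; simpa using him.symm
      refine ⟨fun h => huv (hu.trans h.1.symm), fun h => huv (hadj u v h huS hvS),
        fun h => huv (congrArg κ h), Or.inr (Or.inr ⟨fun h => ?_, fun h => ?_⟩)⟩
      · obtain ⟨j, hj, rfl⟩ := (hW u).1 h
        exact hmT (Option.some_injective _ ((hw j).symm.trans hu) ▸ hj)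
      · obtain ⟨j, hj, rfl⟩ := (hW v).1 h
        exact hvw (congrArg w (Option.some_injective _ ((hw j).symm.trans hv)))
    have hL : ∀ u v, G.Adj u v → u ∉ S → v ∉ S → u ∈ W → ∃ i, D v i ∧ u = w i := by
      intro u v huv hu hv huW
      obtain ⟨i, hi, rfl⟩ := (hW u).1 huW
      exact ⟨i, ⟨hi, (hadj _ v huv hu hv).symm.trans (hw i), huv.ne'⟩, rfl⟩
    have hGL : ∀ u v, G.Adj u v → (coreGraph S W).Adj u v ∨
        (∃ i, D v i ∧ u = w i) ∨ ∃ i, D u i ∧ v = w i := by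
      intro u v huv
      by_cases huS : u ∈ S
      · exact Or.inl ⟨huv.ne, Or.inl huS⟩
      by_cases hvS : v ∈ S
      · exact Or.inl ⟨huv.ne, Or.inr (Or.inl hvS)⟩
      by_cases huW : u ∈ W
      · exact Or.inr (Or.inl (hL u v huv huS hvS huW))
      by_cases hvW : v ∈ W
      · exact Or.inr (Or.inr (hL v u huv.symm hvS huS hvW))
      exact Or.inl ⟨huv.ne, Or.inr (Or.inr ⟨huW, hvW⟩)⟩
    intro u v
    have h₀ : ∀ u v, 0 ≤ L u v := fun u v => by dsimp only [L]; split_ifs <;> norm_num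
    have h₁ := h₀ u v
    have h₂ := h₀ v u
    simp only [adjMatrix_apply]
    by_cases h : κ u = some m ∧ ∃ i, D v i
    · obtain ⟨ha, hb, hc⟩ := hK u v h
      have e₁ : K u v = 1 := if_pos h
      have e₂ : K v u = 0 := if_neg ha
      rw [if_neg hb, if_pos hc, e₁, e₂]
      linarith
    by_cases h' : κ v = some m ∧ ∃ i, D u i
    · obtain ⟨ha, hb, hc⟩ := hK v u h'
      have e₁ : K v u = 1 := if_pos h'
      have e₂ : K u v = 0 := if_neg ha
      rw [if_neg (mt Adj.symm hb), if_pos hc.symm, e₁, e₂]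
      linarith
    have e₁ : K u v = 0 := if_neg h
    have e₂ : K v u = 0 := if_neg h'
    rw [e₁, e₂]
    by_cases hG : G.Adj u v
    · rw [if_pos hG]
      rcases hGL u v hG with hc | hc | hc
      · rw [if_pos hc]; linarith
      · have e₃ : L u v = 1 := if_pos hc
        split_ifs <;> linarith
      · have e₃ : L v u = 1 := if_pos hc
        split_ifs <;> linarith
    · rw [if_neg hG]
      split_ifs <;> linarith
  have hcol : ∀ v, ∑ u, (L u v - K u v) * x u * x v ≤ 0 ∧
      ((∀ v, 0 < x v) → (∃ i, D v i) → ∑ u, (L u v - K u v) * x u * x v < 0) := by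
    intro v
    by_cases h : ∃ i, D v i
    · obtain ⟨i, hi⟩ := h
      have hLi : ∀ u, L u v = if u = w i then 1 else 0 := by
        intro u
        refine if_congr ⟨?_, fun h => ⟨i, hi, h⟩⟩ rfl rfl
        rintro ⟨j, hj, rfl⟩
        exact congrArg w (Option.some_injective _ (hj.2.1.symm.trans hi.2.1))
      have hKi : ∀ u, K u v = if κ u = some m then 1 else 0 := fun u =>
        if_congr (and_iff_left ⟨i, hi⟩) rfl rfl
      have hsum : ∑ u, (L u v - K u v) * x u * x v = (x (w i) - wt m) * x v := by
        rw [← Finset.sum_mul]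
        congr 1
        simp only [hLi, hKi, sub_mul, Finset.sum_sub_distrib, ite_mul, one_mul, zero_mul,
          Finset.sum_ite_eq', Finset.mem_univ, if_true, wt, Finset.sum_filter]
      have hwt : x (w i) + x v ≤ wt m := by
        refine le_trans ?_ (hm i (Finset.mem_univ i))
        rw [← Finset.sum_pair hi.2.2.symm]
        refine Finset.sum_le_sum_of_subset_of_nonneg ?_ fun u _ _ => hx u
        intro u hu
        rcases Finset.mem_insert.1 hu with rfl | hu
        · simpa using hw i
        · rw [Finset.mem_singleton.1 hu]
          simpa using hi.2.1
      rw [hsum]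
      refine ⟨mul_nonpos_of_nonpos_of_nonneg (by linarith [hx v]) (hx v), fun hpos _ =>
        mul_neg_of_neg_of_pos (by linarith [hpos v]) (hpos v)⟩
    · have e₁ : ∀ u, L u v = 0 := fun u => if_neg fun ⟨i, hi, _⟩ => h ⟨i, hi⟩
      have e₂ : ∀ u, K u v = 0 := fun u => if_neg fun hu => h hu.2
      exact ⟨by simp [e₁, e₂], fun _ h' => absurd h' h⟩
  have hexp : ∑ u, ∑ v, ((coreGraph S W).adjMatrix ℝ u v + (L u v + L v u) - (K u v + K v u))
      * x u * x v = ∑ u, ∑ v, (coreGraph S W).adjMatrix ℝ u v * x u * x v +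
        2 * ∑ v, ∑ u, (L u v - K u v) * x u * x v := by
    have h : ∑ u, ∑ v, (L u v - K u v) * x u * x v = ∑ v, ∑ u, (L u v - K u v) * x u * x v :=
      Finset.sum_comm
    rw [two_mul]
    nth_rw 1 [← h]
    simp only [← Finset.sum_add_distrib]
    exact Finset.sum_congr rfl fun u _ => Finset.sum_congr rfl fun v _ => by ring
  have hle : ∑ u, ∑ v, G.adjMatrix ℝ u v * x u * x v ≤
      ∑ u, ∑ v, (coreGraph S W).adjMatrix ℝ u v * x u * x v +
        2 * ∑ v, ∑ u, (L u v - K u v) * x u * x v := by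
    rw [← hexp]
    refine Finset.sum_le_sum fun u _ => Finset.sum_le_sum fun v _ => ?_
    rw [mul_assoc, mul_assoc]
    exact mul_le_mul_of_nonneg_right (hpt u v) (mul_nonneg (hx u) (hx v))
  have hneg := Finset.sum_nonpos fun v (_ : v ∈ Finset.univ) => (hcol v).1
  refine ⟨W, ?_, ?_, by linarith, fun hpos hge => ?_⟩
  · rw [Finset.disjoint_right]
    intro v hv hvS
    obtain ⟨i, -, rfl⟩ := (hW v).1 hv
    simpa [hw] using (hS _).2 hvS
  · rw [Finset.card_image_of_injective _ hw_inj, hT]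
  · have hzero : ∑ v, ∑ u, (L u v - K u v) * x u * x v = 0 := by linarith
    rw [Finset.sum_eq_zero_iff_of_nonpos fun v _ => (hcol v).1] at hzero
    have hD : ∀ v i, ¬ D v i := fun v i h =>
      ((hcol v).2 hpos ⟨i, h⟩).ne (hzero v (Finset.mem_univ v))
    have hL : ∀ u v, L u v = 0 := fun u v => if_neg fun ⟨i, h, _⟩ => hD v i h
    have hK : ∀ u v, K u v = 0 := fun u v => if_neg fun ⟨_, i, h⟩ => hD v i h
    simp only [hL, hK, add_zero, sub_zero] at hpt
    have hpt' : ∀ u v, 0 ≤ ((coreGraph S W).adjMatrix ℝ u v - G.adjMatrix ℝ u v) * x u * x v :=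
      fun u v => mul_nonneg (mul_nonneg (sub_nonneg.2 (hpt u v)) (hx u)) (hx v)
    have hsum : ∑ u, ∑ v, ((coreGraph S W).adjMatrix ℝ u v - G.adjMatrix ℝ u v) * x u * x v = 0 := by
      refine le_antisymm ?_ (Finset.sum_nonneg fun u _ => Finset.sum_nonneg fun v _ => hpt' u v)
      simp only [sub_mul, Finset.sum_sub_distrib]
      linarith
    rw [Finset.sum_eq_zero_iff_of_nonneg fun u _ => Finset.sum_nonneg fun v _ => hpt' u v] at hsum
    ext u v
    have h := hsum u (Finset.mem_univ u)
    rw [Finset.sum_eq_zero_iff_of_nonneg fun v _ => hpt' u v] at h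
    have h := h v (Finset.mem_univ v)
    have h : (coreGraph S W).adjMatrix ℝ u v - G.adjMatrix ℝ u v = 0 := by
      simpa [(hpos u).ne', (hpos v).ne'] using h
    rw [adjMatrix_apply, adjMatrix_apply] at h
    by_cases h₁ : G.Adj u v <;> by_cases h₂ : (coreGraph S W).Adj u v <;> simp [h₁, h₂] at h ⊢

/-! ### The spectral radius of core graphs -/

/-- The characteristic polynomial of the quotient matrix of
`K_s ∨ (K_{n-2s-1} ∪ (s+1) K_1)` with respect to its three vertex classes, as a real function
of `n`, `s` and `x`. -/
def coreCubic (n s x : ℝ) : ℝ :=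
  x ^ 3 - (n - s - 3) * x ^ 2 - (n - 2 + s ^ 2) * x + s * (s + 1) * (n - 2 * s - 2)

/-- The intermediate value theorem on `[n - t - 2, n]`: the value at the left end is
`-t² (t + 1)`. -/
theorem exists_coreCubic_eq_zero {n t : ℝ} (ht : 1 ≤ t) (hn : 5 * t + 3 ≤ n) :
    ∃ l, n - t - 2 ≤ l ∧ coreCubic n t l = 0 := by
  have hcont : ContinuousOn (coreCubic n t) (Set.Icc (n - t - 2) n) := by
    unfold coreCubic
    fun_prop
  have hlow : coreCubic n t (n - t - 2) ≤ 0 := by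
    have h : coreCubic n t (n - t - 2) = -(t ^ 2 * (t + 1)) := by unfold coreCubic; ring
    rw [h]
    have : 0 ≤ t ^ 2 * (t + 1) := by positivity
    linarith
  have hhigh : 0 ≤ coreCubic n t n := by
    have h : coreCubic n t n = (t + 2) * n + 2 * n ^ 2 +
        t * ((n - 2 * (t + 1)) * (n + 2 * (t + 1)) + 2 * (t + 1) ^ 2) := by
      unfold coreCubic; ring
    have h₀ : 0 ≤ (n - 2 * (t + 1)) * (n + 2 * (t + 1)) := mul_nonneg (by linarith) (by linarith)
    have hn₀ : 0 ≤ n := by linarith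
    rw [h]
    positivity
  obtain ⟨l, hl, h⟩ := intermediate_value_Icc (by linarith) hcont ⟨hlow, hhigh⟩
  exact ⟨l, hl.1, h⟩

/-- For `s > t` the difference of the two cubics is `(s - t) g(x)` with a quadratic `g` that is
increasing from `n - t - 2` on, where, as `s ≤ (n - 2) / 2`, its value is at least
`(n - 2) (n - 2 - 5 t) / 2 - 2 t > 0`. -/
theorem coreCubic_lt_coreCubic {n s t x : ℝ} (ht : 1 ≤ t) (hn : 5 * t + 3 ≤ n) (hst : t < s)
    (hsn : 2 * s + 2 ≤ n) (hx : n - t - 2 ≤ x) : coreCubic n t x < coreCubic n s x := by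
  have h : coreCubic n s x - coreCubic n t x = (s - t) * (x ^ 2 - (s + t) * x +
      (n - 2) * (s + t + 1) - 2 * (s ^ 2 + s * t + t ^ 2 + s + t)) := by
    unfold coreCubic; ring
  have hpos : 0 < x ^ 2 - (s + t) * x +
      (n - 2) * (s + t + 1) - 2 * (s ^ 2 + s * t + t ^ 2 + s + t) := by
    have h₁ : 0 ≤ (x - (n - t - 2)) * (x + (n - t - 2) - (s + t)) :=
      mul_nonneg (by linarith) (by linarith)
    have h₂ : 0 ≤ (n - 2 - 2 * s) * ((n - 2) + 2 * s + t + 2) :=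
      mul_nonneg (by linarith) (by linarith)
    have h₃ : 0 ≤ (n - 2) * (n - 2 - 5 * t - 1) := mul_nonneg (by linarith) (by linarith)
    nlinarith
  have := mul_pos (sub_pos.2 hst) hpos
  linarith

open Classical in
/-- The test vector `y` is `1` on `S`, `s / l` on `W` and `s / (l - (n - 2s - 2))` elsewhere, where
`n = |V|` and `s = |S|`. It satisfies `A y = l y` outside `S`, and on `S` up to an error with the
sign of `coreCubic n s l`. -/
theorem coreGraph_sum_adjMatrix {V : Type*} [Fintype V] {S W : Finset V} (hd : Disjoint S W)
    (hW : W.card = S.card + 1) {l : ℝ} (hl₀ : 0 < l)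
    (hl : (Fintype.card V : ℝ) - 2 * S.card - 2 < l) (hS : 0 < S.card) :
    ∃ y : V → ℝ, (∀ v, 0 < y v) ∧ (∀ v ∈ S, y v = 1) ∧
      (∀ v, v ∉ S → ∑ u, (coreGraph S W).adjMatrix ℝ v u * y u = l * y v) ∧
      ∀ v ∈ S, (l - ∑ u, (coreGraph S W).adjMatrix ℝ v u * y u) *
        (l * (l - (Fintype.card V - 2 * S.card - 2))) =
          coreCubic (Fintype.card V) S.card l := by
  have hS' : (0 : ℝ) < S.card := by exact_mod_cast hS
  have hb : 0 < l - (Fintype.card V - 2 * S.card - 2) := by linarith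
  set b : ℝ := S.card / (l - (Fintype.card V - 2 * S.card - 2))
  set c : ℝ := S.card / l
  have hb₀ : 0 < b := div_pos hS' hb
  have hc₀ : 0 < c := div_pos hS' hl₀
  have hb₁ : b * (l - (Fintype.card V - 2 * S.card - 2)) = S.card := div_mul_cancel₀ _ hb.ne'
  have hc₁ : c * l = S.card := div_mul_cancel₀ _ hl₀.ne'
  let y : V → ℝ := fun v => if v ∈ S then 1 else if v ∈ W then c else b
  have hyS : ∀ v ∈ S, y v = 1 := fun v hv => if_pos hv
  have hyW : ∀ v ∈ W, y v = c := fun v hv => by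
    simp only [y, if_neg (Finset.disjoint_right.1 hd hv), if_pos hv]
  have hyR : ∀ v, v ∉ S → v ∉ W → y v = b := fun v h₁ h₂ => by simp only [y, if_neg h₁, if_neg h₂]
  have hsumS : ∑ u ∈ S, y u = S.card := by rw [Finset.sum_congr rfl hyS]; simp
  have hsumW : ∑ u ∈ W, y u = (S.card + 1) * c := by rw [Finset.sum_congr rfl hyW]; simp [hW]
  have hcardR : ((Finset.univ \ (S ∪ W)).card : ℝ) = Fintype.card V - 2 * S.card - 1 := by
    have h₁ := Finset.card_sdiff_add_card_eq_card (Finset.subset_univ (S ∪ W))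
    rw [Finset.card_union_of_disjoint hd, hW, Finset.card_univ] at h₁
    rw [← h₁]; push_cast; ring
  have hsumR : ∑ u ∈ Finset.univ \ (S ∪ W), y u = (Fintype.card V - 2 * S.card - 1) * b := by
    rw [Finset.sum_congr rfl (g := fun _ => b), Finset.sum_const, nsmul_eq_mul, hcardR]
    intro u hu
    simp only [Finset.mem_sdiff, Finset.mem_univ, Finset.mem_union, not_or, true_and] at hu
    exact hyR u hu.1 hu.2
  have hsumSW : ∑ u ∈ S ∪ W, y u = S.card + (S.card + 1) * c := by
    rw [Finset.sum_union hd, hsumS, hsumW]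
  have hsum : ∑ u, y u =
      S.card + (S.card + 1) * c + (Fintype.card V - 2 * S.card - 1) * b := by
    rw [← Finset.sum_sdiff (Finset.subset_univ (S ∪ W)), hsumR, hsumSW]; ring
  have hadjS : ∀ v ∈ S, ∑ u, (coreGraph S W).adjMatrix ℝ v u * y u = ∑ u, y u - 1 := by
    intro v hv
    rw [← hyS v hv, ← Finset.sum_erase_eq_sub (Finset.mem_univ v)]
    rw [← Finset.sum_subset (Finset.erase_subset v Finset.univ)]
    · refine Finset.sum_congr rfl fun u hu => ?_
      have : (coreGraph S W).Adj v u := ⟨(Finset.ne_of_mem_erase hu).symm, Or.inl hv⟩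
      rw [adjMatrix_apply, if_pos this, one_mul]
    · intro u _ hu
      have : u = v := by simpa using hu
      simp [this]
  have hadjW : ∀ v ∈ W, ∑ u, (coreGraph S W).adjMatrix ℝ v u * y u = ∑ u ∈ S, y u := by
    intro v hv
    have hvS := Finset.disjoint_right.1 hd hv
    rw [← Finset.sum_subset (Finset.subset_univ S)]
    · refine Finset.sum_congr rfl fun u hu => ?_
      have : (coreGraph S W).Adj v u := ⟨fun h => hvS (h ▸ hu), Or.inr (Or.inl hu)⟩
      rw [adjMatrix_apply, if_pos this, one_mul]
    · intro u _ hu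
      have : ¬ (coreGraph S W).Adj v u := by
        rintro ⟨-, h | h | h⟩
        exacts [hvS h, hu h, h.1 hv]
      rw [adjMatrix_apply, if_neg this, zero_mul]
  have hadjR : ∀ v, v ∉ S → v ∉ W →
      ∑ u, (coreGraph S W).adjMatrix ℝ v u * y u = ∑ u, y u - ∑ u ∈ W, y u - y v := by
    intro v hvS hvW
    have hvW' : v ∈ Finset.univ \ W := by simpa using hvW
    rw [← Finset.sum_sdiff (f := y) (Finset.subset_univ W), add_sub_cancel_right,
      ← Finset.sum_erase_eq_sub hvW', ← Finset.sum_subset (Finset.subset_univ _)]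
    · refine Finset.sum_congr rfl fun u hu => ?_
      have hu : u ≠ v ∧ u ∉ W := by simpa using hu
      have : (coreGraph S W).Adj v u := ⟨hu.1.symm, Or.inr (Or.inr ⟨hvW, hu.2⟩)⟩
      rw [adjMatrix_apply, if_pos this, one_mul]
    · intro u _ hu
      have hu : u ≠ v → u ∈ W := by simpa using hu
      have : ¬ (coreGraph S W).Adj v u := by
        rintro ⟨h, h' | h' | h'⟩
        exacts [hvS h', Finset.disjoint_left.1 hd h' (hu h.symm), h'.2 (hu h.symm)]
      rw [adjMatrix_apply, if_neg this, zero_mul]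
  refine ⟨y, fun v => ?_, hyS, fun v hv => ?_, fun v hv => ?_⟩
  · dsimp only [y]
    split_ifs <;> positivity
  · by_cases hvW : v ∈ W
    · rw [hadjW v hvW, hsumS, hyW v hvW]; linarith
    · rw [hadjR v hv hvW, hsum, hsumW, hyR v hv hvW]; linear_combination -hb₁
  · rw [hadjS v hv, hsum]
    unfold coreCubic
    linear_combination -(Fintype.card V - 2 * S.card - 1) * l * hb₁ -
      (S.card + 1) * (l - (Fintype.card V - 2 * S.card - 2)) * hc₁

open Classical in
/-- A zero `l` of the cubic above `n - 2s - 2` is an eigenvalue of the core graph, with an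
eigenvector that is constant on the three vertex classes. -/
theorem le_adjSpectralRadius_coreGraph {V : Type*} [Fintype V] {S W : Finset V} (hd : Disjoint S W)
    (hW : W.card = S.card + 1) {l : ℝ} (hl₀ : 0 < l)
    (hl : (Fintype.card V : ℝ) - 2 * S.card - 2 < l) (hS : 0 < S.card)
    (h : coreCubic (Fintype.card V) S.card l = 0) : l ≤ (coreGraph S W).adjSpectralRadius := by
  obtain ⟨y, hy, hyS, hout, hin⟩ := coreGraph_sum_adjMatrix hd hW hl₀ hl hS
  obtain ⟨w, hw⟩ := Finset.card_pos.1 hS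
  have : Nonempty V := ⟨w⟩
  refine (isGreatest_adjSpectralRadius _).2 ?_
  refine Module.End.hasEigenvalue_of_hasEigenvector (x := y)
    (Module.End.hasEigenvector_iff.2 ⟨Module.End.mem_eigenspace_iff.2 (funext fun v => ?_), ?_⟩)
  · rw [Matrix.toLin'_apply, Pi.smul_apply, smul_eq_mul]
    change ∑ u, (coreGraph S W).adjMatrix ℝ v u * y u = l * y v
    by_cases hv : v ∈ S
    · have h₁ := hin v hv
      have hne : l * (l - (Fintype.card V - 2 * S.card - 2)) ≠ 0 :=
        mul_ne_zero hl₀.ne' (by linarith)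
      rw [h, mul_eq_zero, or_iff_left hne] at h₁
      rw [hyS v hv]
      linarith
    · exact hout v hv
  · exact fun h0 => (hy w).ne' (congrFun h0 w)

theorem extremalGraph_eq_coreGraph (n t : ℕ) : extremalGraph n t =
    coreGraph (Finset.univ.map .inl) (Finset.univ.map (.trans .inr .inr)) := by
  ext (u | u | u) (v | v | v) <;> simp [extremalGraph, graphJoin, coreGraph]

/-- `G` is the extremal graph as soon as it is a core graph with parts of the right sizes. -/
theorem nonempty_iso_extremalGraph {V : Type*} [Fintype V] {S W : Finset V} (hd : Disjoint S W)
    {n t : ℕ} (hn : Fintype.card V = n) (hS : S.card = t) (hW : W.card = t + 1) :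
    Nonempty (coreGraph S W ≃g extremalGraph n t) := by
  classical
  let eS : {v // v ∈ S} ≃ Fin t := S.equivFinOfCardEq hS
  let eW : {v // v ∈ W} ≃ Fin (t + 1) := W.equivFinOfCardEq hW
  have hR : (Finset.univ \ (S ∪ W)).card = n - 2 * t - 1 := by
    have h₁ := Finset.card_sdiff_add_card_eq_card (Finset.subset_univ (S ∪ W))
    rw [Finset.card_union_of_disjoint hd, hS, hW, Finset.card_univ] at h₁
    omega
  let eR : {v // v ∈ Finset.univ \ (S ∪ W)} ≃ Fin (n - 2 * t - 1) :=
    Finset.equivFinOfCardEq hR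
  let φ : V → Fin t ⊕ (Fin (n - 2 * t - 1) ⊕ Fin (t + 1)) := fun v =>
    if h : v ∈ S then Sum.inl (eS ⟨v, h⟩)
    else if h' : v ∈ W then Sum.inr (Sum.inr (eW ⟨v, h'⟩))
    else Sum.inr (Sum.inl (eR ⟨v, by simp [h, h']⟩))
  have hφS : ∀ v (h : v ∈ S), φ v = Sum.inl (eS ⟨v, h⟩) := fun v h => dif_pos h
  have hφW : ∀ v (h : v ∉ S) (h' : v ∈ W), φ v = Sum.inr (Sum.inr (eW ⟨v, h'⟩)) :=
    fun v h h' => by simp only [φ, dif_neg h, dif_pos h']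
  have hφR : ∀ v (h : v ∉ S) (h' : v ∉ W),
      φ v = Sum.inr (Sum.inl (eR ⟨v, by simp [h, h']⟩)) :=
    fun v h h' => by simp only [φ, dif_neg h, dif_neg h']
  have hinj : Function.Injective φ := by
    intro u v huv
    by_cases hu : u ∈ S <;> by_cases hv : v ∈ S <;> by_cases hu' : u ∈ W <;>
      by_cases hv' : v ∈ W <;> simp [φ, hu, hv, hu', hv'] at huv <;> exact huv
  have hbij : Function.Bijective φ := by
    rw [Fintype.bijective_iff_injective_and_card]
    refine ⟨hinj, ?_⟩
    have h₁ := Finset.card_le_univ (S ∪ W)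
    rw [Finset.card_union_of_disjoint hd] at h₁
    simp
    omega
  refine ⟨⟨Equiv.ofBijective φ hbij, ?_⟩⟩
  intro u v
  have hne : u = v ↔ φ u = φ v := hinj.eq_iff.symm
  simp only [Equiv.ofBijective_apply, coreGraph, ne_eq, hne]
  by_cases hu : u ∈ S <;> by_cases hv : v ∈ S <;> by_cases hu' : u ∈ W <;>
    by_cases hv' : v ∈ W <;>
    simp [φ, hu, hv, hu', hv', extremalGraph, graphJoin]

/-! ### Comparison of spectral radii -/

open Classical in
/-- The vertices of the independent set of size `t + 1` in the extremal graph have only `t`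
neighbours. -/
theorem not_isPerfectKMatching_of_iso_extremalGraph {V : Type*} [Fintype V] {G : SimpleGraph V}
    {n t k : ℕ} (hk : 0 < k) (φ : G ≃g extremalGraph n t) (f : G.edgeSet → ℕ) :
    ¬ G.IsPerfectKMatching k f := by
  let S := (Finset.univ.map (.inl : Fin t ↪ _)).map φ.symm.toEquiv.toEmbedding
  let W := (Finset.univ.map (.trans .inr .inr :
    Fin (t + 1) ↪ Fin t ⊕ (Fin (n - 2 * t - 1) ⊕ Fin (t + 1)))).map φ.symm.toEquiv.toEmbedding
  refine not_isPerfectKMatching_of_card_lt (S := S) (W := W) hk (by simp [S, W]) ?_ f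
  intro u v huv hu
  have h : (extremalGraph n t).Adj (φ u) (φ v) := φ.map_rel_iff.2 huv
  obtain ⟨i, rfl⟩ : ∃ i, φ.symm (Sum.inr (Sum.inr i)) = u := by
    obtain ⟨a, ha, rfl⟩ := Finset.mem_map.1 hu
    obtain ⟨i, -, rfl⟩ := Finset.mem_map.1 ha
    exact ⟨i, rfl⟩
  obtain ⟨w, rfl⟩ := φ.symm.surjective v
  simp only [RelIso.apply_symm_apply] at h
  rcases w with w | w | w
  · exact Finset.mem_map_of_mem _ (Finset.mem_map_of_mem _ (Finset.mem_univ w))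
  · simp [extremalGraph, graphJoin] at h
  · simp [extremalGraph, graphJoin] at h

open Classical in
/-- The spectral half of the theorem. With a zero `l` of the cubic for `t`, the spectral radius of
`G` is at least `l`, while the quadratic form of a core graph with `s ≥ t` hubs is at most `l ‖x‖²`.
Equality forces `x > 0`, then `s = t`, and then that `G` is the core graph. -/
theorem nonempty_iso_extremalGraph_of_adjSpectralRadius_le {V : Type*} [Fintype V]
    {G : SimpleGraph V} {t : ℕ} (ht : 1 ≤ t) (heven : Even (Fintype.card V))
    (hn : 5 * t + 3 ≤ Fintype.card V) (hconn : G.IsVertexConnected t)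
    (hρ : (extremalGraph (Fintype.card V) t).adjSpectralRadius ≤ G.adjSpectralRadius)
    (hG : ¬ ∃ M : G.Subgraph, M.IsPerfectMatching) :
    Nonempty (G ≃g extremalGraph (Fintype.card V) t) := by
  have hne : Nonempty V := Fintype.card_pos_iff.1 (by omega)
  obtain ⟨S, α, _, κ, hS, hsurj, hadj, hcard⟩ := exists_component_labelling heven hG
  have hts : t ≤ S.card := by
    obtain ⟨i, j, hij⟩ := Fintype.exists_pair_of_one_lt_card (α := α) (by omega)
    obtain ⟨u, hu⟩ := hsurj i
    obtain ⟨v, hv⟩ := hsurj j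
    exact hconn.le_card_of_labelling hadj (mt (hS u).2 (by simp [hu])) (mt (hS v).2 (by simp [hv]))
      (by simpa [hu, hv] using hij)
  have hsn : 2 * S.card + 2 ≤ Fintype.card V := by
    choose w hw using hsurj
    have hinj : Function.Injective w := fun i j h => by
      have := hw i; rw [h, hw j] at this; exact (Option.some_injective _ this).symm
    have hdisj : Disjoint S (Finset.univ.image w) := by
      rw [Finset.disjoint_right]
      intro v hv hvS
      obtain ⟨i, -, rfl⟩ := Finset.mem_image.1 hv
      simpa [hw] using (hS _).2 hvS
    have := Finset.card_le_univ (S ∪ Finset.univ.image w)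
    rw [Finset.card_union_of_disjoint hdisj, Finset.card_image_of_injective _ hinj,
      Finset.card_univ] at this
    omega
  have ht' : (1 : ℝ) ≤ t := by exact_mod_cast ht
  have hn' : 5 * (t : ℝ) + 3 ≤ Fintype.card V := by exact_mod_cast hn
  have hts' : (t : ℝ) ≤ S.card := by exact_mod_cast hts
  have hsn' : 2 * (S.card : ℝ) + 2 ≤ Fintype.card V := by exact_mod_cast hsn
  obtain ⟨l, hl, hl_zero⟩ := exists_coreCubic_eq_zero ht' hn'
  have hl₀ : 0 < l := by linarith
  have hlρ : l ≤ G.adjSpectralRadius := by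
    refine le_trans ?_ hρ
    have hV : Fintype.card (Fin t ⊕ (Fin (Fintype.card V - 2 * t - 1) ⊕ Fin (t + 1))) =
        Fintype.card V := by
      simp; omega
    have hT : (Finset.univ.map (.inl : Fin t ↪ Fin t ⊕ (Fin (Fintype.card V - 2 * t - 1) ⊕
      Fin (t + 1)))).card = t := by simp
    rw [extremalGraph_eq_coreGraph]
    refine le_adjSpectralRadius_coreGraph ?_ (by simp) hl₀ ?_ ?_ ?_
    · simp [Finset.disjoint_left]
    · rw [hV, hT]; linarith
    · rw [hT]; exact ht
    · rw [hV, hT]; exact hl_zero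
  obtain ⟨x, hx, ⟨v₀, hv₀⟩, hxρ⟩ := exists_nonneg_adjSpectralRadius_le G
  obtain ⟨W, hd, hW, hle, heq⟩ := exists_coreGraph_quadraticForm_le hS hsurj hadj hcard hx
  have hs₀ : 0 < S.card := by omega
  obtain ⟨y, hy, hyS, hout, hin⟩ := coreGraph_sum_adjMatrix hd hW hl₀ (by linarith) hs₀
  have hcubic : 0 ≤ coreCubic (Fintype.card V) S.card l := by
    rcases hts'.eq_or_lt with h | h
    · rw [← h, hl_zero]
    · rw [← hl_zero]
      exact (coreCubic_lt_coreCubic ht' hn' h hsn' hl).le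
  have hfac : 0 < l * (l - (Fintype.card V - 2 * S.card - 2)) := mul_pos hl₀ (by linarith)
  have hxl : l * ∑ u, x u ^ 2 ≤ ∑ u, ∑ v, G.adjMatrix ℝ u v * x u * x v :=
    le_trans (mul_le_mul_of_nonneg_right hlρ (Finset.sum_nonneg fun u _ => sq_nonneg _)) hxρ
  have hAy : ∀ u, ∑ v, (coreGraph S W).adjMatrix ℝ u v * y v ≤ l * y u := by
    intro u
    by_cases hu : u ∈ S
    · have := nonneg_of_mul_nonneg_left (hcubic.trans_eq (hin u hu).symm) hfac
      rw [hyS u hu]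
      linarith
    · exact (hout u hu).le
  have hsymm : ∀ u v, (coreGraph S W).adjMatrix ℝ u v = (coreGraph S W).adjMatrix ℝ v u :=
    fun u v => by simp [adjMatrix_apply, adj_comm]
  have hnonneg : ∀ u v, 0 ≤ (coreGraph S W).adjMatrix ℝ u v := fun u v => by
    rw [adjMatrix_apply]; split_ifs <;> norm_num
  obtain ⟨hsupp, hratio⟩ := eq_of_le_quadraticForm hsymm hnonneg hy hAy (hxl.trans hle)
  obtain ⟨s₀, hs₀S⟩ := Finset.card_pos.1 hs₀
  -- Every vertex is adjacent to the hub `s₀`, so `x` is a multiple of `y`.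
  have hhub : ∀ v, x v / y v = x s₀ / y s₀ := by
    intro v
    by_cases hv : v = s₀
    · rw [hv]
    · refine hratio v s₀ ?_
      have : (coreGraph S W).Adj v s₀ := ⟨hv, Or.inr (Or.inl hs₀S)⟩
      simp [adjMatrix_apply, this]
  have hpos : ∀ v, 0 < x v := by
    intro v
    refine (hx v).lt_of_ne' fun h => div_ne_zero hv₀ (hy v₀).ne' ?_
    rw [hhub v₀, ← hhub v, h, zero_div]
  have hst : S.card = t := by
    by_contra hne
    have hlt : (t : ℝ) < S.card := by exact_mod_cast lt_of_le_of_ne hts (Ne.symm hne)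
    have h₁ := coreCubic_lt_coreCubic ht' hn' hlt hsn' hl
    have h₂ := hsupp s₀ (hpos s₀).ne'
    rw [hl_zero, ← hin s₀ hs₀S, h₂, hyS s₀ hs₀S] at h₁
    simp at h₁
  -- The test vector bounds the quadratic form of the core graph by `l ‖x‖²`.
  have hform : ∑ u, ∑ v, (coreGraph S W).adjMatrix ℝ u v * x u * x v ≤ l * ∑ u, x u ^ 2 := by
    have hxy : ∀ v, x v = x s₀ / y s₀ * y v := fun v => by
      rw [← hhub v, div_mul_cancel₀ _ (hy v).ne']
    rw [Finset.mul_sum]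
    refine Finset.sum_le_sum fun u _ => ?_
    have h : ∑ v, (coreGraph S W).adjMatrix ℝ u v * x u * x v =
        x s₀ / y s₀ * x u * ∑ v, (coreGraph S W).adjMatrix ℝ u v * y v := by
      rw [Finset.mul_sum]
      refine Finset.sum_congr rfl fun v _ => ?_
      rw [hxy v]; ring
    rw [h, hsupp u (hpos u).ne']
    have := hxy u
    exact le_of_eq (by linear_combination -(l * x u) * this)
  rw [heq hpos (hform.trans hxl)]
  exact nonempty_iso_extremalGraph hd rfl hst (by rw [hW, hst])

end SimpleGraph

theorem theorem1p2 {V : Type*} [Fintype V] (G : SimpleGraph V) (t k n : ℕ)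
    (ht : 1 ≤ t) (hk : Odd k) (hcard : Fintype.card V = n) (heven : Even n)
    (hn : 5 * t + 3 ≤ n) (hconn : G.IsVertexConnected t)
    (hρ : (SimpleGraph.extremalGraph n t).adjSpectralRadius ≤ G.adjSpectralRadius) :
    (∃ f : G.edgeSet → ℕ, G.IsPerfectKMatching k f) ↔
      ¬ Nonempty (G ≃g SimpleGraph.extremalGraph n t) := by
  subst hcard
  refine ⟨fun ⟨f, hf⟩ ⟨φ⟩ =>
    SimpleGraph.not_isPerfectKMatching_of_iso_extremalGraph hk.pos φ f hf, fun h => ?_⟩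
  by_contra hf
  refine h (SimpleGraph.nonempty_iso_extremalGraph_of_adjSpectralRadius_le ht heven hn hconn hρ ?_)
  exact fun ⟨M, hM⟩ => hf (SimpleGraph.exists_isPerfectKMatching_of_isPerfectMatching hM k)
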